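/- All Banach spaces are real, and for $1\le p<\infty$ we write $\ell_p=\ell_p(\mathbb N)$. For a map $f:X\to Y$ between Banach spaces and $t\ge 0$ let \[\omega_f(t)=\sup\{\|f(x)-f(y)\| : \|x-y\|\le t\},\qquad \rho_f(t)=\inf\{\|f(x)-f(y)\| : \|x-y\|\ge t\}.\] The map $f$ is \emph{coarse} if $\omega_f(t)<\infty$ for all $t\ge 0$; a \emph{coarse embedding} if it is coarse and $\lim_{t\to\infty}\rho_f(t)=\infty$; a \emph{uniform embedding} if $\lim_{t\to 0^+}\omega_f(t)=0$ and $\rho_f(t)>0$ for all $t>0$. It satisfies \emph{Property $(*)$} if there are $\beta>\alpha>0$ with $\inf_{\|x-y\|\in[\alpha,\beta]}\|f(x)-f(y)\|>0$. It is \emph{weakly sequentially continuous} if $x_n\to x$ weakly in $X$ implies $f(x_n)\to f(x)$ weakly in $Y$. \textbf{Corollary 1.6.} (i) If $1\le p<q<\infty$, then there is no weakly sequentially continuous map $\ell_q\to\ell_p$ which is coarse and satisfies Property $(*)$. (ii) The existence of a weakly sequentially continuous coarse (resp. uniform) embedding between Banach spaces is strictly stronger than coarse (resp. uniform) embeddability.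 Precisely: for all Banach spaces $X$ and $Y$, if there is a weakly sequentially continuous coarse (resp. uniform) embedding $X\to Y$, then there is a coarse (resp. uniform) embedding $X\to Y$. On the other hand, for all $p,q\in[1,2]$ there are a coarse embedding $\ell_q\to\ell_p$ and a uniform embedding $\ell_q\to\ell_p$, while for $1\le p<q\le 2$ there is neither a coarse embedding nor a uniform embedding $\ell_q\to\ell_p$ that is weakly sequentially continuous. -/

import Mathlib

open Filter Topology
open scoped ENNReal

noncomputable section

namespace WeakSeqEmb

/-- The real sequence space `ℓ_p`. -/
abbrev ell (p : ℝ≥0∞) : Type := lp (fun _ : ℕ => ℝ) p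

section Maps

variable {X Y : Type*} [NormedAddCommGroup X] [NormedAddCommGroup Y]

/-- The modulus of uniform continuity `ω_f(t) = sup {‖f x - f y‖ : ‖x - y‖ ≤ t}`, with values in
`[0, ∞]`. -/
def modCont (f : X → Y) (t : ℝ) : ℝ≥0∞ :=
  ⨆ (x : X) (y : X) (_ : ‖x - y‖ ≤ t), ‖f x - f y‖ₑ

/-- The modulus of expansion `ρ_f(t) = inf {‖f x - f y‖ : ‖x - y‖ ≥ t}`, with values in `[0, ∞]`
(the infimum of the empty set is `∞`). -/
def modExp (f : X → Y) (t : ℝ) : ℝ≥0∞ :=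
  ⨅ (x : X) (y : X) (_ : t ≤ ‖x - y‖), ‖f x - f y‖ₑ

/-- `f` is coarse: `ω_f(t) < ∞` for all `t ≥ 0`. -/
def IsCoarseMap (f : X → Y) : Prop := ∀ t : ℝ, 0 ≤ t → modCont f t < ∞

/-- `f` is a coarse embedding: it is coarse and `ρ_f(t) → ∞` as `t → ∞`. -/
def IsCoarseEmbedding (f : X → Y) : Prop :=
  IsCoarseMap f ∧ Tendsto (modExp f) atTop (𝓝 ∞)

/-- `f` is a uniform embedding: `ω_f(t) → 0` as `t → 0⁺` and `ρ_f(t) > 0` for all `t > 0`. -/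
def IsUnifEmbedding (f : X → Y) : Prop :=
  Tendsto (modCont f) (𝓝[>] 0) (𝓝 0) ∧ ∀ t : ℝ, 0 < t → 0 < modExp f t

/-- Property (∗): for some `β > α > 0`, the infimum of `‖f x - f y‖` over all `x, y` with
`‖x - y‖ ∈ [α, β]` is positive. -/
def PropertyStar (f : X → Y) : Prop :=
  ∃ α β : ℝ, 0 < α ∧ α < β ∧
    0 < ⨅ (x : X) (y : X) (_ : ‖x - y‖ ∈ Set.Icc α β), ‖f x - f y‖ₑ

/-- `f` maps weakly convergent sequences to weakly convergent sequences, preserving limits. -/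
def WeaklySeqContinuous [NormedSpace ℝ X] [NormedSpace ℝ Y] (f : X → Y) : Prop :=
  ∀ (u : ℕ → X) (x : X),
    Tendsto (fun n => toWeakSpace ℝ X (u n)) atTop (𝓝 (toWeakSpace ℝ X x)) →
      Tendsto (fun n => toWeakSpace ℝ Y (f (u n))) atTop (𝓝 (toWeakSpace ℝ Y (f x)))

end Maps

section Spaces

variable (X Y : Type*) [NormedAddCommGroup X] [NormedAddCommGroup Y]

/-- `X` coarsely embeds into `Y`. -/
def CoarselyEmbeds : Prop := ∃ f : X → Y, IsCoarseEmbedding f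

/-- `X` uniformly embeds into `Y`. -/
def UniformlyEmbeds : Prop := ∃ f : X → Y, IsUnifEmbedding f

variable [NormedSpace ℝ X] [NormedSpace ℝ Y]

/-- `X` coarsely embeds into `Y` by a weakly sequentially continuous map. -/
def WeakSeqCoarselyEmbeds : Prop :=
  ∃ f : X → Y, WeaklySeqContinuous f ∧ IsCoarseEmbedding f

/-- `X` uniformly embeds into `Y` by a weakly sequentially continuous map. -/
def WeakSeqUniformlyEmbeds : Prop :=
  ∃ f : X → Y, WeaklySeqContinuous f ∧ IsUnifEmbedding f

end Spaces

end WeakSeqEmb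

end

namespace WeakSeqEmb

/-! ### Moduli, large-scale Lipschitz bounds, Property (∗) -/

section Moduli

variable {X Y : Type*} [NormedAddCommGroup X] [NormedAddCommGroup Y]

/-! Nonexistence. Property (∗) says that moving a point of `ℓ_q` by a suitable length `α` moves its
image by at least `δ`. As `1 < q < ∞`, `α e_n` is weakly null, so `f (x + α e_n)` tends weakly to `f
x`; in `ℓ_p` such a perturbation adds almost `δ ^ p` to the `p`-th power of the norm
(`eventually_le_norm_add_rpow`). Choosing `k` indices one after another yields a sum of `k` vectors
`α e_i` whose image is at distance at least of order `k ^ (1/p)` from `f 0`. Its norm is only `α k ^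
(1/q)`, and a coarse map on a normed space is Lipschitz at large distances, so `p < q` is
contradictory for large `k`. Coarse and uniform embeddings are both coarse with Property (∗).

Existence. Compose bi-Hölder maps `ℓ_q → ℓ_2 → ℓ_1 → ℓ_p`; a bi-Hölder map is both a coarse and a
uniform embedding. Each map that is not an identity comes from Assouad's superposition of scales
(`exists_powDist_of_bounded_lipschitz`). For `ℓ_r → ℓ_s` with `r < s` it is applied in every
coordinate to the circle map `(cos, sin)`. For `ℓ_2 → ℓ_1` it is applied to normalised exponential
vectors, whose inner products form the Gaussian kernel, followed by the Mazur map. -/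

theorem norm_sub_le_of_modCont {f : X → Y} {t : ℝ} (h : modCont f t < ∞) {x y : X}
    (hxy : ‖x - y‖ ≤ t) : ‖f x - f y‖ ≤ (modCont f t).toReal := by
  have h1 : ‖f x - f y‖ₑ ≤ modCont f t :=
    le_iSup_of_le x (le_iSup_of_le y (le_iSup_of_le hxy le_rfl))
  have := ENNReal.toReal_mono h.ne h1
  simpa using this

/-- Cut the segment from `y` to `x` into `n` equal steps of length at most `τ`. -/
theorem norm_sub_le_of_chain [NormedSpace ℝ X] {f : X → Y} {τ M : ℝ}
    (h : ∀ x y, ‖x - y‖ ≤ τ → ‖f x - f y‖ ≤ M) (n : ℕ) (x y : X) (hxy : ‖x - y‖ ≤ n * τ) :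
    ‖f x - f y‖ ≤ n * M := by
  induction n generalizing x with
  | zero =>
    have : x = y := by
      have : ‖x - y‖ ≤ 0 := by simpa using hxy
      simpa [sub_eq_zero] using this
    simp [this]
  | succ n ih =>
    have hn : (0 : ℝ) < n + 1 := by positivity
    push_cast at hxy ⊢
    set z : X := y + ((n : ℝ) / (n + 1)) • (x - y) with hz
    have h1 : ‖x - z‖ ≤ τ := by
      have : x - z = (1 / ((n : ℝ) + 1)) • (x - y) := by
        have e : (1 / ((n : ℝ) + 1)) = 1 - (n : ℝ) / (n + 1) := by field_simp; ring
        rw [hz, e, sub_smul, one_smul]; abel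
      rw [this, norm_smul, Real.norm_of_nonneg (by positivity), one_div_mul_eq_div,
        div_le_iff₀ hn]
      linarith
    have h2 : ‖z - y‖ ≤ n * τ := by
      have : z - y = ((n : ℝ) / (n + 1)) • (x - y) := by rw [hz]; abel
      rw [this, norm_smul, Real.norm_of_nonneg (by positivity), div_mul_eq_mul_div,
        div_le_iff₀ hn]
      have := mul_le_mul_of_nonneg_left hxy (Nat.cast_nonneg (α := ℝ) n)
      linarith
    have h3 := norm_add_le (f x - f z) (f z - f y)
    rw [sub_add_sub_cancel] at h3
    linarith [h x z h1, ih z h2]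

theorem IsCoarseMap.exists_norm_sub_le [NormedSpace ℝ X] {f : X → Y} (hf : IsCoarseMap f) :
    ∃ L : ℝ, 0 ≤ L ∧ ∀ x y, ‖f x - f y‖ ≤ L * (‖x - y‖ + 1) := by
  refine ⟨(modCont f 1).toReal, ENNReal.toReal_nonneg, fun x y => ?_⟩
  have h := norm_sub_le_of_chain
    (fun x y => norm_sub_le_of_modCont (hf 1 zero_le_one)) ⌈‖x - y‖⌉₊ x y
    (by simpa using Nat.le_ceil ‖x - y‖)
  refine h.trans ?_
  rw [mul_comm]
  exact mul_le_mul_of_nonneg_left (Nat.ceil_lt_add_one (norm_nonneg _)).le ENNReal.toReal_nonneg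

theorem isCoarseMap_of_chain [NormedSpace ℝ X] {f : X → Y} {τ M : ℝ} (hτ : 0 < τ)
    (h : ∀ x y, ‖x - y‖ ≤ τ → ‖f x - f y‖ ≤ M) : IsCoarseMap f := by
  intro t _
  obtain ⟨n, hn⟩ := exists_nat_ge (t / τ)
  refine lt_of_le_of_lt (b := ENNReal.ofReal (n * M)) ?_ ENNReal.ofReal_lt_top
  refine iSup_le fun x => iSup_le fun y => iSup_le fun hxy => ?_
  rw [← ofReal_norm]
  exact ENNReal.ofReal_le_ofReal (norm_sub_le_of_chain h n x y
    (hxy.trans ((div_le_iff₀ hτ).1 hn)))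

theorem IsUnifEmbedding.isCoarseMap [NormedSpace ℝ X] {f : X → Y} (hf : IsUnifEmbedding f) :
    IsCoarseMap f := by
  have h := hf.1.eventually (gt_mem_nhds ENNReal.zero_lt_top)
  obtain ⟨τ, h1, hτ⟩ := (h.and self_mem_nhdsWithin).exists
  exact isCoarseMap_of_chain hτ (fun x y => norm_sub_le_of_modCont h1)

theorem propertyStar_of_modExp_pos {f : X → Y} {t : ℝ} (ht : 0 < t) (h : 0 < modExp f t) :
    PropertyStar f := by
  refine ⟨t, t + 1, ht, by linarith, h.trans_le ?_⟩
  exact iInf_mono fun x => iInf_mono fun y => iInf_mono' fun hxy => ⟨hxy.1, le_rfl⟩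

theorem IsUnifEmbedding.propertyStar {f : X → Y} (hf : IsUnifEmbedding f) : PropertyStar f :=
  propertyStar_of_modExp_pos one_pos (hf.2 1 one_pos)

theorem IsCoarseEmbedding.propertyStar {f : X → Y} (hf : IsCoarseEmbedding f) :
    PropertyStar f := by
  have h := hf.2.eventually (lt_mem_nhds ENNReal.zero_lt_top)
  obtain ⟨t, h1, ht⟩ := (h.and (eventually_gt_atTop 0)).exists
  exact propertyStar_of_modExp_pos ht h1

theorem PropertyStar.exists_le_norm_sub {f : X → Y} (hf : PropertyStar f) :
    ∃ α δ : ℝ, 0 < α ∧ 0 < δ ∧ ∀ x y, ‖x - y‖ = α → δ ≤ ‖f x - f y‖ := by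
  obtain ⟨α, β, hα, hαβ, h⟩ := hf
  obtain ⟨δ, hδ, hδ'⟩ := ENNReal.lt_iff_exists_nnreal_btwn.1 h
  refine ⟨α, δ, hα, by exact_mod_cast hδ, fun x y hxy => ?_⟩
  have : (δ : ℝ≥0∞) ≤ ‖f x - f y‖ₑ := hδ'.le.trans
    (iInf_le_of_le x (iInf_le_of_le y (iInf_le_of_le (by rw [hxy]; exact ⟨le_rfl, hαβ.le⟩) le_rfl)))
  rw [enorm_eq_nnnorm] at this
  exact_mod_cast this

end Moduli

/-! ### Weak convergence in `ℓ_q` -/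

section WeakConvergence

theorem tendsto_toWeakSpace_iff {X : Type*} [NormedAddCommGroup X] [NormedSpace ℝ X]
    {u : ℕ → X} {x : X} :
    Tendsto (fun n => toWeakSpace ℝ X (u n)) atTop (𝓝 (toWeakSpace ℝ X x)) ↔
      ∀ φ : X →L[ℝ] ℝ, Tendsto (fun n => φ (u n)) atTop (𝓝 (φ x)) := by
  have hinj : Function.Injective (topDualPairing ℝ X).flip := by
    intro a b hab
    by_contra hne
    obtain ⟨g, hg⟩ := SeparatingDual.exists_separating_of_ne (R := ℝ) hne
    exact hg (LinearMap.congr_fun hab g)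
  exact WeakBilin.tendsto_iff_forall_eval_tendsto (topDualPairing ℝ X).flip hinj

theorem norm_sum_single_const {q : ℝ≥0∞} (hq : 0 < q.toReal) (E : Finset ℕ) {ε : ℕ → ℝ} {t : ℝ}
    (hε : ∀ i ∈ E, |ε i| = t) :
    ‖∑ i ∈ E, (lp.single q i (ε i) : ell q)‖ ^ q.toReal = E.card * t ^ q.toReal := by
  rw [lp.norm_sum_single hq]
  rw [Finset.sum_congr rfl (g := fun _ => t ^ q.toReal) (fun i hi => by rw [Real.norm_eq_abs, hε i hi])]
  simp

variable {q : ℝ≥0∞} [Fact (1 ≤ q)]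

/-- If `|φ e_i| ≥ c` for infinitely many `i`, a signed sum of `k` such unit vectors has norm `k ^
(1/q)` but `φ`-value at least `c k`, which is impossible for large `k` since `q > 1`. No description
of the dual is needed. -/
theorem tendsto_eval_single (hq : 1 < q) (hq' : q < ∞) (φ : ell q →L[ℝ] ℝ) :
    Tendsto (fun n => φ (lp.single q n (1 : ℝ))) atTop (𝓝 0) := by
  have hr : 1 < q.toReal := by
    simpa using (ENNReal.toReal_lt_toReal ENNReal.one_ne_top hq'.ne).2 hq
  rw [Metric.tendsto_nhds]
  intro c hc
  by_contra hcon
  rw [not_eventually, Nat.frequently_atTop_iff_infinite] at hcon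
  have key : ∀ k : ℕ, c * k ≤ ‖φ‖ * (k : ℝ) ^ (1 / q.toReal) := by
    intro k
    obtain ⟨E, hE, hk⟩ := hcon.exists_subset_card_eq k
    set ε : ℕ → ℝ := fun i => if 0 ≤ φ (lp.single q i (1 : ℝ)) then 1 else -1 with hε
    set v : ell q := ∑ i ∈ E, lp.single q i (ε i) with hv
    have h1 : ‖v‖ ^ q.toReal = k := by
      rw [hv, norm_sum_single_const (by linarith) E (t := 1), hk]
      · simp
      · intro i _; simp only [hε]; split_ifs <;> simp
    have h2 : ‖v‖ = (k : ℝ) ^ (1 / q.toReal) := by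
      rw [← h1, one_div, Real.rpow_rpow_inv (norm_nonneg _) (by linarith)]
    have h3 : c * k ≤ φ v := by
      rw [hv, map_sum, ← hk, mul_comm, ← nsmul_eq_mul]
      refine Finset.card_nsmul_le_sum _ _ _ fun i hi => ?_
      have h4 : (lp.single q i (ε i) : ell q) = ε i • lp.single q i (1 : ℝ) := by
        rw [← lp.single_smul]; simp
      have h5 : c ≤ |φ (lp.single q i (1 : ℝ))| := by
        simpa [Real.dist_eq] using hE hi
      rw [h4, map_smul, smul_eq_mul]
      simp only [hε]
      split_ifs with h0
      · rwa [abs_of_nonneg h0, ← one_mul (φ _)] at h5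
      · rw [abs_of_neg (not_le.1 h0)] at h5; linarith
    calc c * k ≤ φ v := h3
      _ ≤ ‖φ v‖ := le_abs_self _
      _ ≤ ‖φ‖ * ‖v‖ := φ.le_opNorm v
      _ = _ := by rw [h2]
  have hlim : Tendsto (fun k : ℕ => ‖φ‖ * ((k : ℝ)) ^ (-(1 - 1 / q.toReal))) atTop (𝓝 (‖φ‖ * 0)) :=
    ((tendsto_rpow_neg_atTop (by
      rw [sub_pos, div_lt_one (by linarith)]; exact hr)).comp
        tendsto_natCast_atTop_atTop).const_mul _
  rw [mul_zero] at hlim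
  refine absurd (ge_of_tendsto hlim ?_) (not_le.2 hc)
  filter_upwards [eventually_gt_atTop 0] with k hk
  have hk' : (0 : ℝ) < k := by exact_mod_cast hk
  have := key k
  rw [show -(1 - 1 / q.toReal) = 1 / q.toReal - 1 by ring, Real.rpow_sub hk', Real.rpow_one,
    ← mul_div_assoc, le_div_iff₀ hk']
  exact this

theorem tendsto_toWeakSpace_add_single (hq : 1 < q) (hq' : q < ∞) (x : ell q) (t : ℝ) :
    Tendsto (fun n => toWeakSpace ℝ (ell q) (x + lp.single q n t)) atTop
      (𝓝 (toWeakSpace ℝ (ell q) x)) := by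
  rw [tendsto_toWeakSpace_iff]
  intro φ
  have h := ((tendsto_eval_single hq hq' φ).const_mul t).const_add (φ x)
  rw [mul_zero, add_zero] at h
  refine h.congr fun n => ?_
  have h4 : (lp.single q n t : ell q) = t • lp.single q n (1 : ℝ) := by
    rw [← lp.single_smul]; simp
  rw [map_add, h4, map_smul, smul_eq_mul]

theorem tendsto_apply_of_tendsto_toWeakSpace {u : ℕ → ell q} {x : ell q}
    (h : Tendsto (fun n => toWeakSpace ℝ (ell q) (u n)) atTop (𝓝 (toWeakSpace ℝ (ell q) x)))
    (i : ℕ) : Tendsto (fun n => u n i) atTop (𝓝 (x i)) :=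
  tendsto_toWeakSpace_iff.1 h (lp.evalCLM ℝ (fun _ : ℕ => ℝ) q i)

end WeakConvergence

/-! ### Asymptotic lower estimate in `ℓ_p` -/

section LowerEstimate

variable {p : ℝ≥0∞} [Fact (1 ≤ p)]

/-- Gliding hump: `a` lives almost entirely on a finite set `E`, and `w n` eventually almost off
`E`, so the `p`-th powers nearly add. Half of `δ ^ p` is given up to absorb the errors. -/
theorem eventually_le_norm_add_rpow (hp : p ≠ ∞) (a : ell p) {w : ℕ → ell p}
    (hw : ∀ i, Tendsto (fun n => w n i) atTop (𝓝 0)) {δ : ℝ} (hδ : 0 < δ)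
    (hwδ : ∀ n, δ ≤ ‖w n‖) :
    ∀ᶠ n in atTop, ‖a‖ ^ p.toReal + δ ^ p.toReal / 2 ≤ ‖a + w n‖ ^ p.toReal := by
  have hs : 0 < p.toReal := ENNReal.toReal_pos (zero_lt_one.trans_le Fact.out).ne' hp
  set s := p.toReal with hsdef
  let T : Finset ℕ → ell p → ell p := fun E v => v - ∑ i ∈ E, lp.single p i (v i)
  have hT : ∀ E v, ‖v‖ ^ s = ∑ i ∈ E, ‖v i‖ ^ s + ‖T E v‖ ^ s := fun E v => by
    have := lp.norm_sub_norm_compl_sub_single hs v E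
    simp only [T]; linarith
  have hTadd : ∀ E u v, T E (u + v) = T E u + T E v := fun E u v => by
    simp only [T, lp.coeFn_add, Pi.add_apply, lp.single_add, Finset.sum_add_distrib]; abel
  have hTlim : Tendsto (fun E => ‖T E a‖) atTop (𝓝 0) := by
    have h : Tendsto (fun E : Finset ℕ => ∑ i ∈ E, (lp.single p i (a i) : ell p)) atTop (𝓝 a) :=
      lp.hasSum_single hp a
    simpa [T] using (h.const_sub a).norm
  have hcont : Tendsto (fun η : ℝ => (max 0 (δ - η)) ^ s - η ^ s) (𝓝 0) (𝓝 (δ ^ s)) := by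
    have : ContinuousAt (fun η : ℝ => (max 0 (δ - η)) ^ s - η ^ s) 0 := by
      refine ContinuousAt.sub (ContinuousAt.rpow_const (by fun_prop) (Or.inr hs.le))
        (ContinuousAt.rpow_const (by fun_prop) (Or.inr hs.le))
    simpa [ContinuousAt, hδ.le, Real.zero_rpow hs.ne'] using this
  -- The tail `η` of `a` off `E` costs twice: `η ^ s` for cutting `a` down to `E`, and `η` in the
  -- triangle inequality off `E`. Both must fit in the margin `δ ^ s / 2`.
  obtain ⟨E, hE⟩ := ((hcont.comp hTlim).eventually
    (lt_mem_nhds (half_lt_self (Real.rpow_pos_of_pos hδ s)))).exists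
  simp only [Function.comp] at hE
  set η := ‖T E a‖ with hη
  have hlim : Tendsto (fun n => ∑ i ∈ E, ‖a i + w n i‖ ^ s
      + (max 0 (δ - ∑ i ∈ E, ‖w n i‖ - η)) ^ s) atTop
      (𝓝 (∑ i ∈ E, ‖a i‖ ^ s + (max 0 (δ - η)) ^ s)) := by
    refine Tendsto.add (tendsto_finsetSum _ fun i _ => ?_) ?_
    · have := ((hw i).const_add (a i)).norm
      rw [add_zero] at this
      exact this.rpow_const (Or.inr hs.le)
    · have h1 : Tendsto (fun n => ∑ i ∈ E, ‖w n i‖) atTop (𝓝 (∑ i ∈ E, (0 : ℝ))) :=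
        tendsto_finsetSum _ fun i _ => by simpa using (hw i).norm
      rw [Finset.sum_const_zero] at h1
      have h2 := ((h1.const_sub δ).sub_const η)
      rw [sub_zero] at h2
      exact (tendsto_const_nhds.max h2).rpow_const (Or.inr hs.le)
  have hlt : ‖a‖ ^ s + δ ^ s / 2 < ∑ i ∈ E, ‖a i‖ ^ s + (max 0 (δ - η)) ^ s := by
    rw [hT E a]; linarith
  filter_upwards [hlim.eventually (lt_mem_nhds hlt)] with n hn
  refine hn.le.trans ?_
  rw [hT E (a + w n)]
  refine add_le_add (le_of_eq rfl) (Real.rpow_le_rpow (le_max_left _ _) ?_ hs.le)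
  refine max_le (norm_nonneg _) ?_
  rw [hTadd]
  have h1 : ‖T E (w n)‖ ≤ ‖T E a + T E (w n)‖ + ‖T E a‖ := by
    have := norm_sub_le (T E a + T E (w n)) (T E a)
    rwa [add_sub_cancel_left] at this
  have h2 : ‖w n‖ ≤ ‖T E (w n)‖ + ∑ i ∈ E, ‖w n i‖ := by
    have h3 : w n = T E (w n) + ∑ i ∈ E, lp.single p i (w n i) := by simp [T]
    calc ‖w n‖ = ‖T E (w n) + ∑ i ∈ E, lp.single p i (w n i)‖ := by rw [← h3]
      _ ≤ ‖T E (w n)‖ + ‖∑ i ∈ E, (lp.single p i (w n i) : ell p)‖ := norm_add_le _ _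
      _ ≤ _ := by
        gcongr
        refine (norm_sum_le _ _).trans (Finset.sum_le_sum fun i _ => ?_)
        rw [lp.norm_single (zero_lt_one.trans_le Fact.out)]
  linarith [hwδ n]

end LowerEstimate

/-! ### Nonexistence of weakly sequentially continuous maps -/

section Nonexistence

variable {p q : ℝ≥0∞} [Fact (1 ≤ p)] [Fact (1 ≤ q)]

theorem exists_finset_le_norm_sub_rpow (hp : p ≠ ∞) (hq : 1 < q) (hq' : q < ∞)
    {f : ell q → ell p} (hf : WeaklySeqContinuous f) {α δ : ℝ} (hα : 0 < α) (hδ : 0 < δ)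
    (h : ∀ x y, ‖x - y‖ = α → δ ≤ ‖f x - f y‖) (k : ℕ) :
    ∃ E : Finset ℕ, E.card = k ∧
      k * (δ ^ p.toReal / 2) ≤ ‖f (∑ i ∈ E, lp.single q i α) - f 0‖ ^ p.toReal := by
  induction k with
  | zero => exact ⟨∅, rfl, by simp; positivity⟩
  | succ k ih =>
    obtain ⟨E, hE, hk⟩ := ih
    set x : ell q := ∑ i ∈ E, lp.single q i α with hx
    have hweak := hf _ _ (tendsto_toWeakSpace_add_single hq hq' x α)
    have hev := eventually_le_norm_add_rpow hp (f x - f 0)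
      (w := fun n => f (x + lp.single q n α) - f x)
      (fun i => by
        have := (tendsto_apply_of_tendsto_toWeakSpace hweak i).sub_const (f x i)
        simpa using this) hδ
      (fun n => h _ _ (by
        rw [add_sub_cancel_left, lp.norm_single (zero_lt_one.trans hq), Real.norm_of_nonneg hα.le]))
    -- The index must also be new, so that adding `α e_n` is the same as enlarging `E`.
    obtain ⟨n, hn, hnE⟩ := (hev.and (E.finite_toSet.eventually_cofinite_notMem.filter_mono
      Nat.cofinite_eq_atTop.ge)).exists
    refine ⟨insert n E, ?_, ?_⟩
    · rw [Finset.card_insert_of_notMem (by simpa using hnE), hE]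
    · rw [Finset.sum_insert (by simpa using hnE), ← hx, add_comm (lp.single q n α) x]
      rw [sub_add_sub_comm, add_comm (f x), add_sub_add_right_eq_sub] at hn
      push_cast
      linarith

theorem not_exists_weaklySeqContinuous (hpq : p < q) (hq' : q < ∞) :
    ¬ ∃ f : ell q → ell p, WeaklySeqContinuous f ∧ IsCoarseMap f ∧ PropertyStar f := by
  rintro ⟨f, hf, hcoarse, hstar⟩
  have hp1 : 1 ≤ p := Fact.out
  have hp : p ≠ ∞ := (hpq.trans hq').ne
  have hs : 0 < p.toReal := ENNReal.toReal_pos (zero_lt_one.trans_le hp1).ne' hp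
  have hsr : p.toReal < q.toReal := (ENNReal.toReal_lt_toReal hp hq'.ne).2 hpq
  set s := p.toReal
  set r := q.toReal with hr
  have hr0 : 0 < r := hs.trans hsr
  obtain ⟨α, δ, hα, hδ, h⟩ := hstar.exists_le_norm_sub
  obtain ⟨L, hL, hLip⟩ := hcoarse.exists_norm_sub_le
  set c := (δ ^ s / 2) ^ (1 / s) with hc
  have hδs : 0 < δ ^ s / 2 := half_pos (Real.rpow_pos_of_pos hδ s)
  have hcpos : 0 < c := Real.rpow_pos_of_pos hδs _
  -- Lower growth from the inductive construction against the large-scale Lipschitz bound; dividing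
  -- by `k ^ (1 / s)` forces `c ≤ 0` in the limit.
  have key : ∀ k : ℕ, (k : ℝ) ^ (1 / s) * c ≤ L * (α * (k : ℝ) ^ (1 / r) + 1) := by
    intro k
    obtain ⟨E, hE, hk⟩ := exists_finset_le_norm_sub_rpow hp (hp1.trans_lt hpq) hq' hf hα hδ h k
    set x : ell q := ∑ i ∈ E, lp.single q i α with hx
    have hxn : ‖x‖ = α * (k : ℝ) ^ (1 / r) := by
      have := norm_sum_single_const (q := q) hr0 E (ε := fun _ => α) (fun i _ => abs_of_pos hα)
      rw [← hx, hE, ← hr] at this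
      rw [← Real.rpow_rpow_inv (norm_nonneg x) hr0.ne', this,
        Real.mul_rpow (by positivity) (by positivity), Real.rpow_rpow_inv hα.le hr0.ne', one_div,
        mul_comm]
    rw [hc, ← Real.mul_rpow (by positivity) hδs.le, ← hxn]
    have h1 := Real.rpow_le_rpow (by positivity) hk (one_div_pos.2 hs).le
    rw [one_div, Real.rpow_rpow_inv (norm_nonneg _) hs.ne', ← one_div] at h1
    simpa using h1.trans (hLip x 0)
  have hgap : 0 < 1 / s - 1 / r := sub_pos.2 (one_div_lt_one_div_of_lt hs hsr)
  have hlim : Tendsto (fun k : ℕ => L * (α * ((k : ℝ)) ^ (-(1 / s - 1 / r)) + (k : ℝ) ^ (-(1 / s))))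
      atTop (𝓝 (L * (α * 0 + 0))) :=
    ((((tendsto_rpow_neg_atTop hgap).comp tendsto_natCast_atTop_atTop).const_mul α).add
      ((tendsto_rpow_neg_atTop (one_div_pos.2 hs)).comp tendsto_natCast_atTop_atTop)).const_mul L
  rw [mul_zero, add_zero, mul_zero] at hlim
  refine absurd (ge_of_tendsto hlim ?_) (not_le.2 hcpos)
  filter_upwards [eventually_gt_atTop 0] with k hk
  have hk' : (0 : ℝ) < k := by exact_mod_cast hk
  have h2 := key k
  rw [mul_comm, ← le_div_iff₀ (Real.rpow_pos_of_pos hk' _)] at h2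
  refine h2.trans (le_of_eq ?_)
  rw [show -(1 / s - 1 / r) = 1 / r - 1 / s by ring, Real.rpow_sub hk', Real.rpow_neg hk'.le]
  have := (Real.rpow_pos_of_pos hk' (1 / s)).ne'
  field_simp

end Nonexistence

end WeakSeqEmb

noncomputable section

namespace WeakSeqEmb

/-! ### Bi-Hölder maps -/

section BiHolder

variable {X Y Z : Type*} [NormedAddCommGroup X] [NormedAddCommGroup Y] [NormedAddCommGroup Z]

/-- `f` distorts distances like a power function, up to multiplicative constants. -/
def IsBiHolder (f : X → Y) : Prop :=
  ∃ θ c C : ℝ, 0 < θ ∧ 0 < c ∧ 0 < C ∧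
    ∀ x y, c * ‖x - y‖ ^ θ ≤ ‖f x - f y‖ ∧ ‖f x - f y‖ ≤ C * ‖x - y‖ ^ θ

theorem isBiHolder_id : IsBiHolder (id : X → X) :=
  ⟨1, 1, 1, one_pos, one_pos, one_pos, fun x y => by simp⟩

theorem IsBiHolder.comp {g : Y → Z} {f : X → Y} (hg : IsBiHolder g) (hf : IsBiHolder f) :
    IsBiHolder (g ∘ f) := by
  obtain ⟨θ, c, C, hθ, hc, hC, h⟩ := hf
  obtain ⟨θ', c', C', hθ', hc', hC', h'⟩ := hg
  refine ⟨θ * θ', c' * c ^ θ', C' * C ^ θ', by positivity, by positivity, by positivity,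
    fun x y => ⟨?_, ?_⟩⟩
  · refine le_trans ?_ (h' (f x) (f y)).1
    rw [mul_assoc, Real.rpow_mul (norm_nonneg _), ← Real.mul_rpow hc.le (by positivity)]
    gcongr
    exact (h x y).1
  · refine (h' (f x) (f y)).2.trans ?_
    rw [mul_assoc, Real.rpow_mul (norm_nonneg _), ← Real.mul_rpow hC.le (by positivity)]
    gcongr
    exact (h x y).2

theorem IsBiHolder.exists_modCont_le {f : X → Y} (hf : IsBiHolder f) :
    ∃ θ C : ℝ, 0 < θ ∧ ∀ t, modCont f t ≤ ENNReal.ofReal (C * t ^ θ) := by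
  obtain ⟨θ, c, C, hθ, hc, hC, h⟩ := hf
  refine ⟨θ, C, hθ, fun t => iSup_le fun x => iSup_le fun y => iSup_le fun hxy => ?_⟩
  rw [← ofReal_norm]
  refine ENNReal.ofReal_le_ofReal ((h x y).2.trans ?_)
  gcongr

theorem IsBiHolder.exists_le_modExp {f : X → Y} (hf : IsBiHolder f) :
    ∃ θ c : ℝ, 0 < θ ∧ 0 < c ∧ ∀ t, 0 ≤ t → ENNReal.ofReal (c * t ^ θ) ≤ modExp f t := by
  obtain ⟨θ, c, C, hθ, hc, hC, h⟩ := hf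
  refine ⟨θ, c, hθ, hc, fun t ht => le_iInf fun x => le_iInf fun y => le_iInf fun hxy => ?_⟩
  rw [← ofReal_norm]
  refine ENNReal.ofReal_le_ofReal (le_trans ?_ (h x y).1)
  gcongr

theorem IsBiHolder.isCoarseEmbedding {f : X → Y} (hf : IsBiHolder f) : IsCoarseEmbedding f := by
  constructor
  · obtain ⟨θ, C, -, h⟩ := hf.exists_modCont_le
    exact fun t _ => (h t).trans_lt ENNReal.ofReal_lt_top
  · obtain ⟨θ, c, hθ, hc, h⟩ := hf.exists_le_modExp
    refine tendsto_nhds_top_mono (ENNReal.tendsto_ofReal_atTop.comp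
      ((tendsto_rpow_atTop hθ).const_mul_atTop hc)) ?_
    filter_upwards [eventually_ge_atTop 0] with t ht using h t ht

theorem IsBiHolder.isUnifEmbedding {f : X → Y} (hf : IsBiHolder f) : IsUnifEmbedding f := by
  constructor
  · obtain ⟨θ, C, hθ, h⟩ := hf.exists_modCont_le
    have h0 : Tendsto (fun t : ℝ => ENNReal.ofReal (C * t ^ θ)) (𝓝 0) (𝓝 0) := by
      have : ContinuousAt (fun t : ℝ => C * t ^ θ) 0 :=
        continuousAt_const.mul (continuousAt_id.rpow_const (Or.inr hθ.le))
      have h1 := (ENNReal.continuous_ofReal.tendsto _).comp this.tendsto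
      simpa [Function.comp_def, Real.zero_rpow hθ.ne'] using h1
    exact tendsto_of_tendsto_of_tendsto_of_le_of_le tendsto_const_nhds
      (h0.mono_left nhdsWithin_le_nhds) (fun _ => zero_le) h
  · obtain ⟨θ, c, hθ, hc, h⟩ := hf.exists_le_modExp
    exact fun t ht => (ENNReal.ofReal_pos.2 (by positivity)).trans_le (h t ht.le)

end BiHolder

/-! ### From extended power distances to maps into `ℓ_p` -/

section PowDist

variable {I : Type*}

/-- The `s`-th power of the `ℓ_s`-distance of two families of reals, with values in `[0, ∞]`. -/
def powDist (s : ℝ) (u v : I → ℝ) : ℝ≥0∞ := ∑' i, ‖u i - v i‖ₑ ^ s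

theorem enorm_rpow_eq_ofReal {s : ℝ} (hs : 0 ≤ s) (a : ℝ) : ‖a‖ₑ ^ s = ENNReal.ofReal (|a| ^ s) := by
  rw [Real.enorm_eq_ofReal_abs, ENNReal.ofReal_rpow_of_nonneg (abs_nonneg _) hs]

/-- A family of maps into `I → ℝ` with power-type `ℓ_p`-distances yields a bi-Hölder map
into `ℓ_p`. -/
theorem exists_isBiHolder_of_powDist [Countable I] [Infinite I] {X : Type*}
    [NormedAddCommGroup X] {p : ℝ≥0∞} [Fact (1 ≤ p)] (hp : p ≠ ∞) {σ : ℝ} (hσ : 0 < σ)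
    {c C : ℝ≥0∞} (hc : c ≠ 0) (hC : C ≠ ∞) {F : X → I → ℝ} (hF0 : F 0 = 0)
    (hF : ∀ x y, c * ENNReal.ofReal (‖x - y‖ ^ σ) ≤ powDist p.toReal (F x) (F y) ∧
      powDist p.toReal (F x) (F y) ≤ C * ENNReal.ofReal (‖x - y‖ ^ σ)) :
    ∃ f : X → ell p, IsBiHolder f := by
  have hs : 0 < p.toReal := ENNReal.toReal_pos (zero_lt_one.trans_le Fact.out).ne' hp
  set s := p.toReal
  obtain ⟨_⟩ := nonempty_denumerable_iff.2 (⟨inferInstance, inferInstance⟩ : Countable I ∧ Infinite I)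
  let e : ℕ ≃ I := (Denumerable.eqv I).symm
  have hfin : ∀ x y, powDist s (F x) (F y) ≠ ∞ := fun x y =>
    ne_top_of_le_ne_top (ENNReal.mul_ne_top hC ENNReal.ofReal_ne_top) (hF x y).2
  have htoReal : ∀ a : ℝ, (‖a‖ₑ ^ s).toReal = ‖a‖ ^ s := fun a => by
    rw [← ENNReal.toReal_rpow, toReal_enorm]
  have hmem : ∀ x, Memℓp (fun n => F x (e n)) p := fun x => by
    refine memℓp_gen ?_
    have h := ENNReal.summable_toReal (hfin x 0)
    simp only [hF0, Pi.zero_apply, sub_zero, htoReal] at h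
    exact e.summable_iff.2 h
  let f : X → ell p := fun x => ⟨fun n => F x (e n), hmem x⟩
  have hnorm : ∀ x y, ‖f x - f y‖ ^ s = (powDist s (F x) (F y)).toReal := fun x y => by
    rw [lp.norm_rpow_eq_tsum hs, powDist, ENNReal.tsum_toReal_eq (fun i =>
      ENNReal.rpow_ne_top_of_nonneg hs.le enorm_ne_top)]
    simp only [htoReal]
    exact e.tsum_eq (fun i => ‖F x i - F y i‖ ^ s)
  -- `c` may be `∞` and `C` may be `0`; `min c 1` and `C + 1` have positive real values.
  refine ⟨f, σ / s, (min c 1).toReal ^ (1 / s), (C + 1).toReal ^ (1 / s), by positivity, ?_, ?_,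
    fun x y => ?_⟩
  · refine Real.rpow_pos_of_pos (ENNReal.toReal_pos ?_ ?_) _
    · exact (lt_min (pos_iff_ne_zero.2 hc) one_pos).ne'
    · exact ne_top_of_le_ne_top ENNReal.one_ne_top (min_le_right _ _)
  · exact Real.rpow_pos_of_pos (ENNReal.toReal_pos (by simp) (by simpa using hC)) _
  have hd : (0 : ℝ) ≤ ‖x - y‖ ^ σ := by positivity
  have hpow : ‖x - y‖ ^ (σ / s) = (‖x - y‖ ^ σ) ^ (1 / s) := by
    rw [← Real.rpow_mul (norm_nonneg _), mul_one_div]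
  have hN : ‖f x - f y‖ = (‖f x - f y‖ ^ s) ^ (1 / s) := by
    rw [one_div, Real.rpow_rpow_inv (norm_nonneg _) hs.ne']
  rw [hpow, hN, hnorm, ← Real.mul_rpow ENNReal.toReal_nonneg hd,
    ← Real.mul_rpow ENNReal.toReal_nonneg hd]
  constructor
  · refine Real.rpow_le_rpow (by positivity) ?_ (by positivity)
    have h := ENNReal.toReal_mono (hfin x y)
      ((mul_le_mul_left (min_le_left c 1) _).trans (hF x y).1)
    rwa [ENNReal.toReal_mul, ENNReal.toReal_ofReal hd] at h
  · refine Real.rpow_le_rpow (by positivity) ?_ (by positivity)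
    have h := ENNReal.toReal_mono (ENNReal.mul_ne_top (by simpa using hC) ENNReal.ofReal_ne_top)
      ((hF x y).2.trans (mul_le_mul_left (le_self_add (b := 1)) _))
    rwa [ENNReal.toReal_mul, ENNReal.toReal_ofReal hd] at h

end PowDist

/-! ### Assouad's superposition of scales -/

section Assouad

/-- Geometric at both ends: ratio `2 ^ (-σ)` towards `+∞` by boundedness, and `2 ^ (-(s - σ))`
towards `-∞` by the Lipschitz bound. This is where `0 < σ < s` enters. -/
theorem summable_two_rpow_min {s σ : ℝ} (hσ : 0 < σ) (hσs : σ < s) :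
    Summable fun k : ℤ => (2 : ℝ) ^ (-(σ * k)) * min 1 ((2 : ℝ) ^ ((k + 1) * s)) := by
  have h2 : (0 : ℝ) < 2 := two_pos
  have hgeo : ∀ a : ℝ, 0 < a → Summable fun n : ℕ => ((2 : ℝ) ^ (-a)) ^ n := fun a ha =>
    summable_geometric_of_lt_one (by positivity)
      (Real.rpow_lt_one_of_one_lt_of_neg one_lt_two (by linarith))
  have hnn : ∀ k : ℤ, 0 ≤ (2 : ℝ) ^ (-(σ * k)) * min 1 ((2 : ℝ) ^ ((k + 1) * s)) := fun k => by
    positivity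
  refine Summable.of_nat_of_neg ?_ ?_
  · refine Summable.of_nonneg_of_le (fun n => hnn n) (fun n => ?_) (hgeo σ hσ)
    rw [← Real.rpow_mul_natCast h2.le, neg_mul]
    exact mul_le_of_le_one_right (by positivity) (min_le_left _ _)
  · refine Summable.of_nonneg_of_le (fun n => hnn _) (fun n => ?_)
      ((hgeo (s - σ) (by linarith)).mul_left ((2 : ℝ) ^ s))
    refine (mul_le_mul_of_nonneg_left (min_le_right _ _) (by positivity)).trans (le_of_eq ?_)
    rw [← Real.rpow_mul_natCast h2.le, ← Real.rpow_add h2, ← Real.rpow_add h2]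
    push_cast
    congr 1
    ring

/-- Assouad's construction: superposing rescaled copies of a bounded Lipschitz map that separates
points at distance in `[1, 2]` gives a map that turns the norm into a power of itself. -/
theorem exists_powDist_of_bounded_lipschitz {X : Type*} [NormedAddCommGroup X] [NormedSpace ℝ X]
    {I : Type*} {s σ : ℝ} (hσ : 0 < σ) (hσs : σ < s) {c C : ℝ≥0∞} (hc : c ≠ 0) (hC : C ≠ ∞)
    {φ : X → I → ℝ}
    (hupper : ∀ x y, powDist s (φ x) (φ y) ≤ C * ENNReal.ofReal (min 1 (‖x - y‖ ^ s)))
    (hlower : ∀ x y, 1 ≤ ‖x - y‖ → ‖x - y‖ ≤ 2 → c ≤ powDist s (φ x) (φ y)) :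
    ∃ (F : X → ℤ × I → ℝ) (c' C' : ℝ≥0∞), F 0 = 0 ∧ c' ≠ 0 ∧ C' ≠ ∞ ∧
      ∀ x y, c' * ENNReal.ofReal (‖x - y‖ ^ σ) ≤ powDist s (F x) (F y) ∧
        powDist s (F x) (F y) ≤ C' * ENNReal.ofReal (‖x - y‖ ^ σ) := by
  have hs : 0 < s := hσ.trans hσs
  have h2 : (0 : ℝ) < 2 := two_pos
  -- The weight becomes `2 ^ (-σ n)` after the `s`-th power; subtracting `φ 0` gives `F 0 = 0`.
  let F : X → ℤ × I → ℝ := fun x j =>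
    (2 : ℝ) ^ (-(σ / s * j.1)) * (φ ((2 : ℝ) ^ (j.1 : ℝ) • x) j.2 - φ 0 j.2)
  have hF : ∀ x y, powDist s (F x) (F y) = ∑' n : ℤ, ENNReal.ofReal ((2 : ℝ) ^ (-(σ * n))) *
      powDist s (φ ((2 : ℝ) ^ (n : ℝ) • x)) (φ ((2 : ℝ) ^ (n : ℝ) • y)) := fun x y => by
    rw [powDist, ENNReal.tsum_prod']
    refine tsum_congr fun n => ?_
    rw [powDist, ← ENNReal.tsum_mul_left]
    refine tsum_congr fun i => ?_
    simp only [F]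
    rw [← mul_sub, sub_sub_sub_cancel_right, enorm_mul, ENNReal.mul_rpow_of_nonneg _ _ hs.le,
      enorm_rpow_eq_ofReal hs.le ((2 : ℝ) ^ _), abs_of_pos (by positivity), ← Real.rpow_mul h2.le]
    congr 4
    field_simp
  have hdist : ∀ (n : ℤ) (x y : X), ‖(2 : ℝ) ^ (n : ℝ) • x - (2 : ℝ) ^ (n : ℝ) • y‖
      = (2 : ℝ) ^ (n : ℝ) * ‖x - y‖ := fun n x y => by
    rw [← smul_sub, norm_smul, Real.norm_of_nonneg (by positivity)]
  set b : ℤ → ℝ := fun k => (2 : ℝ) ^ (-(σ * k)) * min 1 ((2 : ℝ) ^ ((k + 1) * s)) with hb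
  refine ⟨F, ENNReal.ofReal ((2 : ℝ) ^ (-σ)) * c, C * ∑' k, ENNReal.ofReal (b k), ?_, ?_, ?_,
    fun x y => ?_⟩
  · ext j; simp [F]
  · exact mul_ne_zero (ENNReal.ofReal_pos.2 (by positivity)).ne' hc
  · exact ENNReal.mul_ne_top hC (summable_two_rpow_min hσ hσs).tsum_ofReal_ne_top
  rcases eq_or_ne x y with rfl | hxy
  · simp [Real.zero_rpow hσ.ne', powDist, hs]
  set d := ‖x - y‖ with hd
  have hd0 : 0 < d := norm_pos_iff.2 (sub_ne_zero.2 hxy)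
  obtain ⟨m, hm1, hm2⟩ := exists_mem_Ico_zpow hd0 one_lt_two
  rw [← Real.rpow_intCast] at hm1 hm2
  push_cast at hm2
  constructor
  · rw [hF]
    -- One scale suffices: dilating by `2 ^ (-m)` brings the distance into `[1, 2)`.
    refine le_trans ?_ (ENNReal.le_tsum (-m))
    have hscale : (2 : ℝ) ^ (((-m : ℤ)) : ℝ) * d = d / 2 ^ (m : ℝ) := by
      push_cast; rw [Real.rpow_neg h2.le]; field_simp
    have hpos : (0 : ℝ) < 2 ^ (m : ℝ) := by positivity
    have hlow := hlower ((2 : ℝ) ^ (((-m : ℤ)) : ℝ) • x) ((2 : ℝ) ^ (((-m : ℤ)) : ℝ) • y)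
      (by rw [hdist, hscale, le_div_iff₀ hpos]; linarith)
      (by
        rw [hdist, hscale, div_le_iff₀ hpos]
        rw [Real.rpow_add h2, Real.rpow_one] at hm2; linarith)
    rw [mul_right_comm, ← ENNReal.ofReal_mul (by positivity)]
    refine mul_le_mul' (ENNReal.ofReal_le_ofReal ?_) hlow
    calc (2 : ℝ) ^ (-σ) * d ^ σ ≤ (2 : ℝ) ^ (-σ) * (2 ^ ((m : ℝ) + 1)) ^ σ := by gcongr
      _ = _ := by
        rw [← Real.rpow_mul h2.le, ← Real.rpow_add h2]
        push_cast
        congr 1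
        ring
  -- Shifting the scale index by `m` extracts the factor `d ^ σ` and leaves a majorant `b k`
  -- independent of `x` and `y`.
  · rw [hF, ← (Equiv.subRight m).tsum_eq, mul_assoc, mul_comm (∑' k, _), ← ENNReal.tsum_mul_left,
      ← ENNReal.tsum_mul_left]
    refine ENNReal.tsum_le_tsum fun k => ?_
    refine (mul_le_mul_right (hupper _ _) _).trans ?_
    rw [hdist, ← mul_assoc, mul_comm _ C, mul_assoc, ← ENNReal.ofReal_mul (by positivity),
      ← ENNReal.ofReal_mul (by positivity)]
    refine mul_le_mul_right (ENNReal.ofReal_le_ofReal ?_) _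
    simp only [Equiv.subRight_apply, hb, ← hd]
    rw [← mul_assoc]
    refine mul_le_mul ?_ (min_le_min le_rfl ?_) (by positivity) (by positivity)
    · calc (2 : ℝ) ^ (-(σ * ((k - m : ℤ) : ℝ))) = (2 ^ (m : ℝ)) ^ σ * (2 : ℝ) ^ (-(σ * k)) := by
            rw [← Real.rpow_mul h2.le, ← Real.rpow_add h2]
            push_cast
            congr 1
            ring
        _ ≤ _ := by gcongr
    · rw [Real.rpow_mul h2.le]
      refine Real.rpow_le_rpow (by positivity) ?_ hs.le
      calc (2 : ℝ) ^ (((k - m : ℤ) : ℝ)) * d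
          ≤ (2 : ℝ) ^ (((k - m : ℤ) : ℝ)) * 2 ^ ((m : ℝ) + 1) := by gcongr
        _ = _ := by
          rw [← Real.rpow_add h2]
          push_cast
          congr 1
          ring

end Assouad

end WeakSeqEmb
end

noncomputable section

namespace WeakSeqEmb

/-! ### Bi-Hölder maps `ℓ_r → ℓ_s` for `r < s` -/

section Snowflake

theorem powDist_cos_sin_le {s : ℝ} (hs : 0 < s) (a b : ℝ) :
    powDist s (fun i : Bool => if i then Real.cos a else Real.sin a)
      (fun i : Bool => if i then Real.cos b else Real.sin b) ≤
      ENNReal.ofReal (2 * 2 ^ s) * ENNReal.ofReal (min 1 (‖a - b‖ ^ s)) := by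
  have aux : ∀ u : ℝ, |u| ≤ 2 → |u| ≤ |a - b| → |u| ^ s ≤ 2 ^ s * min 1 (‖a - b‖ ^ s) := by
    intro u h1 h2
    rw [mul_min_of_nonneg _ _ (by positivity), mul_one, ← Real.mul_rpow two_pos.le (norm_nonneg _)]
    refine le_min (by gcongr) (Real.rpow_le_rpow (abs_nonneg _) ?_ hs.le)
    rw [Real.norm_eq_abs]
    linarith [abs_nonneg (a - b)]
  rw [powDist, tsum_bool, ← ENNReal.ofReal_mul (by positivity)]
  simp only [if_true, Bool.false_eq_true, if_false, enorm_rpow_eq_ofReal hs.le]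
  rw [← ENNReal.ofReal_add (by positivity) (by positivity)]
  refine ENNReal.ofReal_le_ofReal ?_
  have h1 := aux (Real.sin a - Real.sin b) (by
    rw [abs_le]; constructor <;>
    linarith [Real.sin_le_one a, Real.neg_one_le_sin a, Real.sin_le_one b, Real.neg_one_le_sin b])
    (Real.abs_sin_sub_sin_le a b)
  have h2 := aux (Real.cos a - Real.cos b) (by
    rw [abs_le]; constructor <;>
    linarith [Real.cos_le_one a, Real.neg_one_le_cos a, Real.cos_le_one b, Real.neg_one_le_cos b])
    (Real.abs_cos_sub_cos_le a b)
  linarith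

theorem le_powDist_cos_sin {s : ℝ} (hs : 0 < s) {a b : ℝ} (h1 : 1 ≤ ‖a - b‖) (h2 : ‖a - b‖ ≤ 2) :
    ENNReal.ofReal ((1 / 2) ^ s) ≤
    powDist s (fun i : Bool => if i then Real.cos a else Real.sin a)
      (fun i : Bool => if i then Real.cos b else Real.sin b) := by
  rw [Real.norm_eq_abs] at h1 h2
  have hcos : Real.cos (a - b) ≤ 5 / 9 := by
    rw [← Real.cos_abs]
    exact (Real.cos_le_cos_of_nonneg_of_le_pi zero_le_one (h2.trans Real.two_le_pi) h1).trans
      Real.cos_one_le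
  rw [Real.cos_sub] at hcos
  have hsum : 8 / 9 ≤ (Real.cos a - Real.cos b) ^ 2 + (Real.sin a - Real.sin b) ^ 2 := by
    nlinarith [Real.sin_sq_add_cos_sq a, Real.sin_sq_add_cos_sq b]
  rw [powDist, tsum_bool]
  simp only [if_true, Bool.false_eq_true, if_false, enorm_rpow_eq_ofReal hs.le]
  -- Otherwise the squared chord would be below `1 / 2 < 8 / 9`.
  have hor : 1 / 2 ≤ |Real.cos a - Real.cos b| ∨ 1 / 2 ≤ |Real.sin a - Real.sin b| := by
    by_contra! h
    have e1 := sq_abs (Real.cos a - Real.cos b)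
    have e2 := sq_abs (Real.sin a - Real.sin b)
    nlinarith [abs_nonneg (Real.cos a - Real.cos b), abs_nonneg (Real.sin a - Real.sin b)]
  rcases hor with h | h
  · exact le_add_left (ENNReal.ofReal_le_ofReal (Real.rpow_le_rpow (by norm_num) h hs.le))
  · exact le_add_right (ENNReal.ofReal_le_ofReal (Real.rpow_le_rpow (by norm_num) h hs.le))

/-- Taking `σ = r` in each coordinate turns `|x i - y i| ^ r` into an `s`-th power of an
`ℓ_s`-distance, up to constants; summing over `i` gives exactly `‖x - y‖ ^ r`. -/
theorem exists_isBiHolder_of_lt {r s : ℝ≥0∞} [Fact (1 ≤ r)] [Fact (1 ≤ s)] (hrs : r < s)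
    (hs : s ≠ ∞) : ∃ f : ell r → ell s, IsBiHolder f := by
  have hr : r ≠ ∞ := hrs.ne_top
  have hr0 : 0 < r.toReal := ENNReal.toReal_pos (zero_lt_one.trans_le Fact.out).ne' hr
  have hlt : r.toReal < s.toReal := (ENNReal.toReal_lt_toReal hr hs).2 hrs
  have hs0 : 0 < s.toReal := hr0.trans hlt
  obtain ⟨F, c, C, hF0, hc, hC, hF⟩ := exists_powDist_of_bounded_lipschitz hr0 hlt
    (ENNReal.ofReal_pos.2 (by positivity)).ne' ENNReal.ofReal_ne_top (powDist_cos_sin_le hs0)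
    (fun _ _ => le_powDist_cos_sin hs0)
  have hsum : ∀ x y : ell r, ENNReal.ofReal (‖x - y‖ ^ r.toReal)
      = ∑' i, ENNReal.ofReal (‖x i - y i‖ ^ r.toReal) := fun x y => by
    have h := lp.hasSum_norm hr0 (x - y)
    rw [← h.tsum_eq, ENNReal.ofReal_tsum_of_nonneg (fun _ => by positivity) h.summable]
    rfl
  refine exists_isBiHolder_of_powDist (I := ℕ × (ℤ × Bool)) hs hr0 hc hC
    (F := fun x j => F (x j.1) j.2) ?_ fun x y => ?_
  · ext j; simp [hF0]
  · rw [hsum, powDist, ENNReal.tsum_prod', ← ENNReal.tsum_mul_left, ← ENNReal.tsum_mul_left]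
    exact ⟨ENNReal.tsum_le_tsum fun i => (hF (x i) (y i)).1,
      ENNReal.tsum_le_tsum fun i => (hF (x i) (y i)).2⟩

end Snowflake

end WeakSeqEmb
end

noncomputable section

namespace WeakSeqEmb

/-! ### Gaussian kernel, Mazur map, and `ℓ_2 → ℓ_1` -/

section Exponential

/-- Expansion of a power over words of length `n`. Absolute summability is carried along because the
induction multiplies two series. -/
theorem hasSum_prod_apply {z : ℕ → ℝ} (hz : Summable fun i => |z i|) (n : ℕ) :
    (Summable fun w : Fin n → ℕ => |∏ j, z (w j)|) ∧
      HasSum (fun w : Fin n → ℕ => ∏ j, z (w j)) ((∑' i, z i) ^ n) := by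
  induction n with
  | zero =>
    refine ⟨(hasSum_fintype _).summable, ?_⟩
    convert hasSum_fintype (fun w : Fin 0 → ℕ => ∏ j, z (w j)) using 1
    simp
  | succ n ih =>
    let e : ℕ × (Fin n → ℕ) ≃ (Fin (n + 1) → ℕ) := Fin.consEquiv (fun _ => ℕ)
    have he : ∀ p : ℕ × (Fin n → ℕ), ∏ j, z (e p j) = z p.1 * ∏ j, z (p.2 j) := fun p => by
      simp [e, Fin.prod_univ_succ]
    have habs : Summable fun p : ℕ × (Fin n → ℕ) => |z p.1| * |∏ j, z (p.2 j)| :=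
      hz.mul_of_nonneg ih.1 (fun _ => abs_nonneg _) (fun _ => abs_nonneg _)
    constructor
    · rw [← e.summable_iff]
      have hfun : (fun w : Fin (n + 1) → ℕ => |∏ j, z (w j)|) ∘ e
          = fun p => |z p.1| * |∏ j, z (p.2 j)| := by
        funext p
        rw [Function.comp_apply, he, abs_mul]
      rw [hfun]
      exact habs
    · rw [← e.hasSum_iff, pow_succ']
      have hfun : (fun w : Fin (n + 1) → ℕ => ∏ j, z (w j)) ∘ e
          = fun p => z p.1 * ∏ j, z (p.2 j) := by
        funext p
        rw [Function.comp_apply, he]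
      rw [hfun]
      have hsum : Summable fun p : ℕ × (Fin n → ℕ) => z p.1 * ∏ j, z (p.2 j) :=
        Summable.of_abs (habs.congr fun p => (abs_mul _ _).symm)
      have hz' : HasSum z (∑' i, z i) := (Summable.of_abs hz).hasSum
      have hmul := hz'.mul ih.2
      exact hmul hsum

theorem hasSum_prod_div_factorial {z : ℕ → ℝ} (hz : Summable fun i => |z i|) :
    HasSum (fun w : Σ n, Fin n → ℕ => (∏ j, z (w.2 j)) / (w.1.factorial : ℝ))
      (Real.exp (∑' i, z i)) := by
  have hexp := NormedSpace.expSeries_div_hasSum_exp (𝔸 := ℝ) (∑' i, z i)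
  rw [← Real.exp_eq_exp_ℝ] at hexp
  refine hexp.sigma_of_hasSum (fun n => (hasSum_prod_apply hz n).2.div_const _) ?_
  refine Summable.of_abs ((summable_sigma_of_nonneg fun _ => abs_nonneg _).2 ⟨fun n => ?_, ?_⟩)
  · simp only [abs_div]
    exact (hasSum_prod_apply hz n).1.div_const _
  · refine (Real.summable_pow_div_factorial (∑' i, |z i|)).congr fun n => ?_
    have hz' : Summable fun i => |(|z i|)| := by simpa using hz
    have h := ((hasSum_prod_apply hz' n).2.div_const (n.factorial : ℝ)).tsum_eq
    rw [← h]
    refine tsum_congr fun w => ?_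
    rw [abs_div, Finset.abs_prod, Nat.abs_cast]

/-- The normalised exponential vector of `x` in the full Fock space over `ℓ_2`. -/
def expVec (x : ell 2) (w : Σ n, Fin n → ℕ) : ℝ :=
  Real.exp (-(‖x‖ ^ 2 / 2)) * ((∏ j, x (w.2 j)) / √(w.1.factorial : ℝ))

/-- Summed over words, the unnormalised products give `exp ⟪x, y⟫`; the two normalising factors
complete the square. -/
theorem hasSum_expVec_mul (x y : ell 2) :
    HasSum (fun w => expVec x w * expVec y w) (Real.exp (-(‖x - y‖ ^ 2 / 2))) := by
  have hin : HasSum (fun i => y i * x i) (inner ℝ x y) := by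
    simpa using lp.hasSum_inner (𝕜 := ℝ) x y
  have h := (hasSum_prod_div_factorial (z := fun i => y i * x i) hin.summable.abs).mul_left
    (Real.exp (-((‖x‖ ^ 2 + ‖y‖ ^ 2) / 2)))
  rw [hin.tsum_eq, ← Real.exp_add] at h
  have hexp : -((‖x‖ ^ 2 + ‖y‖ ^ 2) / 2) + inner ℝ x y = -(‖x - y‖ ^ 2 / 2) := by
    rw [norm_sub_sq_real]; ring
  rw [hexp] at h
  refine h.congr_fun ?_
  intro w
  have hfac : √(w.1.factorial : ℝ) * √(w.1.factorial : ℝ) = w.1.factorial :=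
    Real.mul_self_sqrt (Nat.cast_nonneg _)
  have he : Real.exp (-((‖x‖ ^ 2 + ‖y‖ ^ 2) / 2))
      = Real.exp (-(‖x‖ ^ 2 / 2)) * Real.exp (-(‖y‖ ^ 2 / 2)) := by
    rw [← Real.exp_add]; congr 1; ring
  rw [expVec, expVec, Finset.prod_mul_distrib, he, mul_mul_mul_comm, div_mul_div_comm, hfac,
    mul_comm (∏ j, y (w.2 j))]

theorem hasSum_expVec_sq (x : ell 2) : HasSum (fun w => expVec x w ^ 2) 1 := by
  simpa [sq] using hasSum_expVec_mul x x

theorem hasSum_expVec_sub_sq (x y : ell 2) :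
    HasSum (fun w => (expVec x w - expVec y w) ^ 2)
      (2 - 2 * Real.exp (-(‖x - y‖ ^ 2 / 2))) := by
  have h := ((hasSum_expVec_sq x).add (hasSum_expVec_sq y)).sub
    ((hasSum_expVec_mul x y).mul_left 2)
  rw [one_add_one_eq_two] at h
  refine h.congr_fun fun w => ?_
  ring

/-- With `sq_sub_div_two_le`, the two-sided control of the Mazur map `a ↦ a |a|` from `ℓ_2` to
`ℓ_1`. -/
theorem abs_mul_abs_sub_le (a b : ℝ) : |(a * |a| - b * |b|)| ≤ |a - b| * (|a| + |b|) := by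
  have h : a * |a| - b * |b| = (a - b) * |a| + b * (|a| - |b|) := by ring
  rw [h]
  refine (abs_add_le _ _).trans ?_
  rw [abs_mul, abs_mul, abs_abs, mul_add, mul_comm |a - b| |b|]
  exact add_le_add_right (mul_le_mul_of_nonneg_left (abs_abs_sub_abs_le a b) (abs_nonneg b)) _

theorem sq_sub_div_two_le (a b : ℝ) : (a - b) ^ 2 / 2 ≤ |(a * |a| - b * |b|)| := by
  rw [le_abs]
  rcases abs_cases a with ⟨ha, ha'⟩ | ⟨ha, ha'⟩ <;> rcases abs_cases b with ⟨hb, hb'⟩ | ⟨hb, hb'⟩ <;>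
    rw [ha, hb]
  · rcases le_total a b with h | h
    · right; nlinarith
    · left; nlinarith
  · left; nlinarith [sq_nonneg (a + b)]
  · right; nlinarith [sq_nonneg (a + b)]
  · rcases le_total a b with h | h
    · right; nlinarith
    · left; nlinarith

/-- The Mazur map into `ℓ_1` applied to `expVec x`. -/
def expVecSq (x : ell 2) (w : Σ n, Fin n → ℕ) : ℝ := expVec x w * |expVec x w|

theorem powDist_expVecSq_le_of_hasSum {x y : ell 2} {g : (Σ n, Fin n → ℕ) → ℝ} {S : ℝ}
    (hg : HasSum g S) (h : ∀ w, |expVecSq x w - expVecSq y w| ≤ g w) :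
    powDist 1 (expVecSq x) (expVecSq y) ≤ ENNReal.ofReal S := by
  rw [← hg.tsum_eq, ENNReal.ofReal_tsum_of_nonneg (fun w => (abs_nonneg _).trans (h w)) hg.summable]
  refine ENNReal.tsum_le_tsum fun w => ?_
  rw [ENNReal.rpow_one, Real.enorm_eq_ofReal_abs]
  exact ENNReal.ofReal_le_ofReal (h w)

theorem powDist_expVecSq_le (x y : ell 2) :
    powDist 1 (expVecSq x) (expVecSq y) ≤
      ENNReal.ofReal 2 * ENNReal.ofReal (min 1 (‖x - y‖ ^ (1 : ℝ))) := by
  rw [← ENNReal.ofReal_mul two_pos.le, Real.rpow_one, mul_min_of_nonneg _ _ two_pos.le, mul_one]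
  rcases eq_or_ne x y with rfl | hxy
  · simp [powDist]
  have hd : 0 < ‖x - y‖ := norm_pos_iff.2 (sub_ne_zero.2 hxy)
  set d := ‖x - y‖ with hd'
  have hsq := (hasSum_expVec_sq x).add (hasSum_expVec_sq y)
  rcases le_total 2 (2 * d) with h | h
  · rw [min_eq_left h, ← one_add_one_eq_two]
    refine powDist_expVecSq_le_of_hasSum hsq fun w => ?_
    refine (abs_sub _ _).trans (le_of_eq ?_)
    simp only [expVecSq, abs_mul, abs_abs, ← sq, sq_abs]
  · rw [min_eq_right h]
    -- A weighted AM-GM replaces Cauchy–Schwarz: `|a - b| (|a| + |b|) ≤ (a - b)² / d + (d / 2) (a² +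
    -- b²)`. Each part sums to at most `d`, giving `2 d`.
    have hsum := ((hasSum_expVec_sub_sq x y).div_const d).add (hsq.mul_left (d / 2))
    refine (powDist_expVecSq_le_of_hasSum hsum fun w => ?_).trans (ENNReal.ofReal_le_ofReal ?_)
    · refine (abs_mul_abs_sub_le _ _).trans ?_
      set a := expVec x w
      set b := expVec y w
      have h1 : |a - b| * (|a| + |b|) * d ≤ (a - b) ^ 2 + d / 2 * (a ^ 2 + b ^ 2) * d := by
        have e1 := sq_abs (a - b)
        have e2 := sq_abs a
        have e3 := sq_abs b
        nlinarith [sq_nonneg (|a - b| - d / 2 * (|a| + |b|)),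
          mul_nonneg (sq_nonneg d) (sq_nonneg (|a| - |b|))]
      rw [← mul_le_mul_iff_left₀ hd, add_mul, div_mul_cancel₀ _ hd.ne']
      exact h1
    · have h1 : 2 - 2 * Real.exp (-(d ^ 2 / 2)) ≤ d ^ 2 := by
        linarith [Real.add_one_le_exp (-(d ^ 2 / 2))]
      have h2 : (2 - 2 * Real.exp (-(d ^ 2 / 2))) / d ≤ d := by
        rw [div_le_iff₀ hd]; linarith
      linarith

theorem le_powDist_expVecSq {x y : ell 2} (h : 1 ≤ ‖x - y‖) :
    ENNReal.ofReal (1 - Real.exp (-(1 / 2))) ≤ powDist 1 (expVecSq x) (expVecSq y) := by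
  have hsum := (hasSum_expVec_sub_sq x y).div_const 2
  have h1 : Real.exp (-(‖x - y‖ ^ 2 / 2)) ≤ Real.exp (-(1 / 2)) :=
    Real.exp_le_exp.2 (by nlinarith)
  calc ENNReal.ofReal (1 - Real.exp (-(1 / 2)))
      ≤ ENNReal.ofReal ((2 - 2 * Real.exp (-(‖x - y‖ ^ 2 / 2))) / 2) :=
        ENNReal.ofReal_le_ofReal (by linarith)
    _ = ∑' w, ENNReal.ofReal ((expVec x w - expVec y w) ^ 2 / 2) := by
        rw [← hsum.tsum_eq, ENNReal.ofReal_tsum_of_nonneg (fun _ => by positivity) hsum.summable]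
    _ ≤ _ := by
        refine ENNReal.tsum_le_tsum fun w => ?_
        rw [ENNReal.rpow_one, Real.enorm_eq_ofReal_abs]
        exact ENNReal.ofReal_le_ofReal (sq_sub_div_two_le _ _)

/-- The superposition is used with `s = 1`; the exponent `σ = 1 / 2` is an arbitrary choice in `(0,
1)`. -/
theorem exists_isBiHolder_two_one : ∃ f : ell 2 → ell 1, IsBiHolder f := by
  have hpos : 0 < 1 - Real.exp (-(1 / 2)) := by
    rw [sub_pos, Real.exp_lt_one_iff]; norm_num
  obtain ⟨F, c, C, hF0, hc, hC, hF⟩ := exists_powDist_of_bounded_lipschitz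
    (σ := 1 / 2) (by norm_num) (by norm_num) (ENNReal.ofReal_pos.2 hpos).ne'
    ENNReal.ofReal_ne_top powDist_expVecSq_le (fun _ _ h _ => le_powDist_expVecSq h)
  exact exists_isBiHolder_of_powDist (p := 1) (σ := 1 / 2) ENNReal.one_ne_top (by norm_num) hc hC hF0
    (by simpa using hF)

end Exponential

/-! ### Composition through `ℓ_2` and `ℓ_1` -/

section Embeddings

theorem exists_isBiHolder_of_le {r s : ℝ≥0∞} [Fact (1 ≤ r)] [Fact (1 ≤ s)] (hrs : r ≤ s)
    (hs : s ≠ ∞) : ∃ f : ell r → ell s, IsBiHolder f := by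
  rcases hrs.eq_or_lt with h | h
  · subst h
    exact ⟨id, isBiHolder_id⟩
  · exact exists_isBiHolder_of_lt h hs

theorem exists_isBiHolder_of_le_two (p q : ℝ≥0∞) [Fact (1 ≤ p)] [Fact (1 ≤ q)] (hp : p ≤ 2)
    (hq : q ≤ 2) : ∃ f : ell q → ell p, IsBiHolder f := by
  obtain ⟨f, hf⟩ := exists_isBiHolder_of_le hq ENNReal.ofNat_ne_top
  obtain ⟨g, hg⟩ := exists_isBiHolder_two_one
  obtain ⟨h, hh⟩ := exists_isBiHolder_of_le (r := 1) (s := p) Fact.out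
    (ne_top_of_le_ne_top ENNReal.ofNat_ne_top hp)
  exact ⟨h ∘ g ∘ f, hh.comp (hg.comp hf)⟩

end Embeddings

end WeakSeqEmb
end

open WeakSeqEmb in
theorem corollary1p6 :
    -- no weakly sequentially continuous coarse map with Property (∗)
    (∀ (p q : ℝ≥0∞) [Fact (1 ≤ p)] [Fact (1 ≤ q)], p < q → q < ∞ →
      ¬ ∃ f : ell q → ell p, WeaklySeqContinuous f ∧ IsCoarseMap f ∧ PropertyStar f) ∧
    -- the weakly sequentially continuous notions imply the plain ones
    (∀ (X Y : Type*) [NormedAddCommGroup X] [NormedSpace ℝ X] [CompleteSpace X]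
        [NormedAddCommGroup Y] [NormedSpace ℝ Y] [CompleteSpace Y],
      (WeakSeqCoarselyEmbeds X Y → CoarselyEmbeds X Y) ∧
        (WeakSeqUniformlyEmbeds X Y → UniformlyEmbeds X Y)) ∧
    -- plain embeddability of `ℓ_q` into `ℓ_p` for `p, q ∈ [1, 2]`
    (∀ (p q : ℝ≥0∞) [Fact (1 ≤ p)] [Fact (1 ≤ q)], p ≤ 2 → q ≤ 2 →
      CoarselyEmbeds (ell q) (ell p) ∧ UniformlyEmbeds (ell q) (ell p)) ∧
    -- the implications cannot be reversed
    (∀ (p q : ℝ≥0∞) [Fact (1 ≤ p)] [Fact (1 ≤ q)], p < q → q ≤ 2 →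
      (CoarselyEmbeds (ell q) (ell p) ∧ ¬ WeakSeqCoarselyEmbeds (ell q) (ell p)) ∧
        (UniformlyEmbeds (ell q) (ell p) ∧ ¬ WeakSeqUniformlyEmbeds (ell q) (ell p))) := by

  refine ⟨fun p q _ _ => not_exists_weaklySeqContinuous, fun X Y _ _ _ _ _ _ => ⟨?_, ?_⟩,
    fun p q _ _ hp hq => ?_, fun p q _ _ hpq hq => ?_⟩
  · exact fun ⟨f, _, hf⟩ => ⟨f, hf⟩
  · exact fun ⟨f, _, hf⟩ => ⟨f, hf⟩
  · obtain ⟨f, hf⟩ := exists_isBiHolder_of_le_two p q hp hq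
    exact ⟨⟨f, hf.isCoarseEmbedding⟩, ⟨f, hf.isUnifEmbedding⟩⟩
  · obtain ⟨f, hf⟩ := exists_isBiHolder_of_le_two p q (hpq.le.trans hq) hq
    have hno := not_exists_weaklySeqContinuous hpq (hq.trans_lt ENNReal.ofNat_lt_top)
    exact ⟨⟨⟨f, hf.isCoarseEmbedding⟩, fun ⟨g, hg, hg'⟩ => hno ⟨g, hg, hg'.1, hg'.propertyStar⟩⟩,
      ⟨⟨f, hf.isUnifEmbedding⟩,
        fun ⟨g, hg, hg'⟩ => hno ⟨g, hg, hg'.isCoarseMap, hg'.propertyStar⟩⟩⟩
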